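/- Let $c\neq 0$ be a real number, let $\Sigma$ be a real-analytic Riemannian surface with Gauss curvature $K$, and let $\nabla$, $\Delta$, $\langle\cdot,\cdot\rangle$ and $\|\cdot\|$ denote its Riemannian gradient, Laplace–Beltrami operator (the trace of the Hessian), metric and norm. Let $\nu:\Sigma\to[-1,1]$ be a real-analytic function satisfying, at every point of $\Sigma$, $$\|\nabla\nu\|^2=-(1-\nu^2)(K-c\nu^2)\qquad\text{and}\qquad \Delta\nu-2K\nu+c(1+\nu^2)\nu=0.$$ Then, at every point of $\Sigma$, $$6c\,\nu\,\langle\nabla\nu,\nabla K\rangle=\|\nabla K\|^2-(K-c\nu^2)\,\Delta K+4(K-c)(K-c\nu^2)(K+2c\nu^2).$$ -/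

import Mathlib

open Bundle
open scoped Manifold ContDiff

namespace RiemannianSurface

noncomputable section

instance instFiniteDimensionalTangentSpace {M : Type*} [TopologicalSpace M]
    [ChartedSpace (EuclideanSpace ℝ (Fin 2)) M] (x : M) :
    FiniteDimensional ℝ (TangentSpace (𝓡 2) x) :=
  inferInstanceAs (FiniteDimensional ℝ (EuclideanSpace ℝ (Fin 2)))

theorem finrank_tangentSpace {M : Type*} [TopologicalSpace M]
    [ChartedSpace (EuclideanSpace ℝ (Fin 2)) M] (x : M) :
    Module.finrank ℝ (TangentSpace (𝓡 2) x) = 2 :=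
  finrank_euclideanSpace_fin (𝕜 := ℝ) (n := 2)

/- A Riemannian surface is modelled as a two-dimensional real-analytic manifold `M` without boundary
whose tangent bundle carries a Riemannian metric (`RiemannianBundle`), which varies analytically
with the base point. Vector fields are sections of the tangent bundle. -/
variable {M : Type*} [TopologicalSpace M] [ChartedSpace (EuclideanSpace ℝ (Fin 2)) M]
  [IsManifold (𝓡 2) ω M] [RiemannianBundle (fun x : M ↦ TangentSpace (𝓡 2) x)]

instance instCompleteSpaceTangentSpace (x : M) : CompleteSpace (TangentSpace (𝓡 2) x) :=
  FiniteDimensional.complete ℝ _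

/-- An orthonormal basis, for the Riemannian metric, of the tangent plane at `x`. -/
def tangentBasis (x : M) : OrthonormalBasis (Fin 2) ℝ (TangentSpace (𝓡 2) x) :=
  (stdOrthonormalBasis ℝ (TangentSpace (𝓡 2) x)).reindex (finCongr (finrank_tangentSpace x))

/-- A vector field extending the tangent vector `v` at `x`, analytic near `x` (it is
constant in the preferred chart at `x`). -/
def extendVector {x : M} (v : TangentSpace (𝓡 2) x) (y : M) : TangentSpace (𝓡 2) y :=
  FiberBundle.extend (EuclideanSpace ℝ (Fin 2)) v y

/-- The derivative `X · f` of the function `f` along the vector field `X`. -/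
def dirDeriv (X : ∀ x : M, TangentSpace (𝓡 2) x) (f : M → ℝ) (x : M) : ℝ :=
  mvfderiv (𝓡 2) f x (X x)

/-- The Riemannian gradient: `⟨∇f, v⟩ = df(v)` for every tangent vector `v`. -/
def grad (f : M → ℝ) (x : M) : TangentSpace (𝓡 2) x :=
  (InnerProductSpace.toDual ℝ (TangentSpace (𝓡 2) x)).symm (mvfderiv (𝓡 2) f x)

/-- The right-hand side of the Koszul formula for `⟨∇_X Y, Z⟩`. -/
def koszul (X Y Z : ∀ x : M, TangentSpace (𝓡 2) x) (x : M) : ℝ :=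
  (1 / 2) *
    (dirDeriv X (fun y ↦ inner ℝ (Y y) (Z y)) x
      + dirDeriv Y (fun y ↦ inner ℝ (Z y) (X y)) x
      - dirDeriv Z (fun y ↦ inner ℝ (X y) (Y y)) x
      + inner ℝ (VectorField.mlieBracket (𝓡 2) X Y x) (Z x)
      - inner ℝ (VectorField.mlieBracket (𝓡 2) Y Z x) (X x)
      + inner ℝ (VectorField.mlieBracket (𝓡 2) Z X x) (Y x))

/-- The Levi-Civita connection `∇_X Y`, built from the Koszul formula: at `x` it is the tangent
vector whose inner product with each vector `e` of an orthonormal basis is given by the Koszul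
formula for `X`, `Y` and a vector field extending `e`. -/
def leviCivita (X Y : ∀ x : M, TangentSpace (𝓡 2) x) (x : M) : TangentSpace (𝓡 2) x :=
  ∑ i, koszul X Y (extendVector (tangentBasis x i)) x • tangentBasis x i

/-- The Hessian `(∇²f)(v, w) = ⟨v, ∇_w ∇f⟩`. -/
def hessian (f : M → ℝ) (x : M) (v w : TangentSpace (𝓡 2) x) : ℝ :=
  inner ℝ v (leviCivita (extendVector w) (grad f) x)

/-- The Laplace-Beltrami operator: the trace of the Hessian with respect to the metric. -/
def laplacian (f : M → ℝ) (x : M) : ℝ :=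
  ∑ i, hessian f x (tangentBasis x i) (tangentBasis x i)

/-- The Riemann curvature `R(X, Y) Z = ∇_Y ∇_X Z - ∇_X ∇_Y Z + ∇_[X,Y] Z`. -/
def riemann (X Y Z : ∀ x : M, TangentSpace (𝓡 2) x) (x : M) : TangentSpace (𝓡 2) x :=
  leviCivita Y (leviCivita X Z) x - leviCivita X (leviCivita Y Z) x
    + leviCivita (VectorField.mlieBracket (𝓡 2) X Y) Z x

/-- The Gauss curvature `K = ⟨R(e₁, e₂) e₁, e₂⟩`, for an orthonormal basis `(e₁, e₂)`. -/
def gaussCurvature (x : M) : ℝ :=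
  inner ℝ
    (riemann (extendVector (tangentBasis x 0)) (extendVector (tangentBasis x 1))
      (extendVector (tangentBasis x 0)) x)
    (tangentBasis x 1)

end

end RiemannianSurface

/-! Bochner's formula, applied to `ν`, reads Δ‖∇ν‖² = 2‖∇²ν‖² + 2⟨∇ν, ∇Δν⟩ + 2K‖∇ν‖². The two
hypotheses express ‖∇ν‖² and Δν through `ν` and `K`, so every term except ‖∇²ν‖² becomes an
expression in `ν`, `K`, ∇ν, ∇K and ΔK.

The Hessian term is controlled by dimension two. Let H be the Hessian, with trace b = Δν.
Differentiating the hypothesis on ‖∇ν‖² gives H∇ν, and Cayley–Hamilton gives ‖∇ν‖²‖H‖² = b²‖∇ν‖² +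
2‖H∇ν‖² − 2b⟨H∇ν, ∇ν⟩. Multiplying Bochner's formula by ‖∇ν‖² therefore eliminates H. The result is
(1 − ν²)² times the desired identity, with no division by K − cν² or by ‖∇ν‖², so critical points of
`ν` need no separate treatment (`curvature_identity_of_frame`, `sq_mul_curvatureDefect_eq_zero`).

The factor (1 − ν²)² is removed locally. If the identity failed at a point, it would fail nearby by
continuity, so ν² = 1 on a neighbourhood. There `ν` has zero derivative, the Laplace equation forces
K = c, and both sides of the identity vanish (`curvatureDefect_eq_zero_of_sq_eq_one`).

All computations take place in a local analytic orthonormal frame (E₁, E₂). The Levi-Civita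
connection, the Gauss curvature and the Laplacian are expressed through the two components of [E₁,
E₂]. Bochner's formula then reduces to commuting frame derivatives (`bochner`). -/

namespace RiemannianSurface

open VectorField Filter Topology

/-! ### Derivations along analytic vector fields, and the Lie bracket as their commutator. -/

section DirectionalDerivative

variable {M : Type*} [TopologicalSpace M] [ChartedSpace (EuclideanSpace ℝ (Fin 2)) M]

/-- The function `f` is real-analytic at `x`. -/
def AnalyticFunAt (f : M → ℝ) (x : M) : Prop := ContMDiffAt (𝓡 2) 𝓘(ℝ) ω f x

variable {X Y Z : ∀ x : M, TangentSpace (𝓡 2) x} {f g : M → ℝ} {x : M}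

namespace AnalyticFunAt

theorem mdiff (hf : AnalyticFunAt f x) : MDifferentiableAt (𝓡 2) 𝓘(ℝ) f x :=
  ContMDiffAt.mdifferentiableAt hf (by simp)

theorem continuousAt (hf : AnalyticFunAt f x) : ContinuousAt f x :=
  ContMDiffAt.continuousAt hf

theorem const (c : ℝ) : AnalyticFunAt (fun _ : M ↦ c) x := contMDiffAt_const

theorem add (hf : AnalyticFunAt f x) (hg : AnalyticFunAt g x) :
    AnalyticFunAt (fun y ↦ f y + g y) x := ContMDiffAt.add hf hg

theorem sub (hf : AnalyticFunAt f x) (hg : AnalyticFunAt g x) :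
    AnalyticFunAt (fun y ↦ f y - g y) x := ContMDiffAt.sub hf hg

theorem neg (hf : AnalyticFunAt f x) : AnalyticFunAt (fun y ↦ -f y) x := ContMDiffAt.neg hf

theorem mul (hf : AnalyticFunAt f x) (hg : AnalyticFunAt g x) :
    AnalyticFunAt (fun y ↦ f y * g y) x := ContMDiffAt.mul hf hg

theorem pow (hf : AnalyticFunAt f x) (n : ℕ) : AnalyticFunAt (fun y ↦ f y ^ n) x :=
  ContMDiffAt.pow hf n

theorem congr (hf : AnalyticFunAt f x) (h : g =ᶠ[𝓝 x] f) : AnalyticFunAt g x :=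
  ContMDiffAt.congr_of_eventuallyEq hf h

end AnalyticFunAt

theorem dirDeriv_add (hf : AnalyticFunAt f x) (hg : AnalyticFunAt g x) :
    dirDeriv X (fun y ↦ f y + g y) x = dirDeriv X f x + dirDeriv X g x := by
  simp [dirDeriv, mvfderiv_fun_add hf.mdiff hg.mdiff]

theorem dirDeriv_sub (hf : AnalyticFunAt f x) (hg : AnalyticFunAt g x) :
    dirDeriv X (fun y ↦ f y - g y) x = dirDeriv X f x - dirDeriv X g x := by
  simp [dirDeriv, mvfderiv_fun_sub hf.mdiff hg.mdiff]

theorem dirDeriv_neg : dirDeriv X (fun y ↦ -f y) x = -dirDeriv X f x := by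
  simp [dirDeriv, mvfderiv_fun_neg]

theorem dirDeriv_mul (hf : AnalyticFunAt f x) (hg : AnalyticFunAt g x) :
    dirDeriv X (fun y ↦ f y * g y) x = f x * dirDeriv X g x + g x * dirDeriv X f x := by
  simp [dirDeriv, mvfderiv_fun_mul hf.mdiff hg.mdiff]

theorem dirDeriv_const (c : ℝ) : dirDeriv X (fun _ ↦ c) x = 0 := by
  simp [dirDeriv, mvfderiv_const]

theorem dirDeriv_congr (h : f =ᶠ[𝓝 x] g) : dirDeriv X f x = dirDeriv X g x := by
  simp only [dirDeriv, mvfderiv]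
  rw [h.mfderiv_eq, h.eq_of_nhds]

theorem dirDeriv_eq_fderiv_chart_self (hf : AnalyticFunAt f x) (v : TangentSpace (𝓡 2) x) :
    mvfderiv (𝓡 2) f x v =
      fderiv ℝ (f ∘ (extChartAt (𝓡 2) x).symm) (extChartAt (𝓡 2) x x) v := by
  have h := hf.mdiff.mvfderiv
  simp only [modelWithCornersSelf_coe, Set.range_id, fderivWithin_univ] at h
  exact congrArg (fun A : EuclideanSpace ℝ (Fin 2) →L[ℝ] ℝ ↦ A v) h

variable [IsManifold (𝓡 2) ω M]

/-- The vector field `X` is real-analytic at `x`. -/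
def AnalyticFieldAt (X : ∀ x : M, TangentSpace (𝓡 2) x) (x : M) : Prop :=
  ContMDiffAt (𝓡 2) (𝓡 2).tangent ω (fun y ↦ (⟨y, X y⟩ : TangentBundle (𝓡 2) M)) x

theorem AnalyticFunAt.eventually (hf : AnalyticFunAt f x) : ∀ᶠ y in 𝓝 x, AnalyticFunAt f y :=
  (contMDiffAt_iff_contMDiffAt_nhds (by simp)).1 hf

theorem AnalyticFieldAt.mdiff (hX : AnalyticFieldAt X x) :
    MDifferentiableAt (𝓡 2) (𝓡 2).tangent (fun y ↦ (⟨y, X y⟩ : TangentBundle (𝓡 2) M)) x :=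
  ContMDiffAt.mdifferentiableAt hX (by simp)

theorem AnalyticFieldAt.eventually (hX : AnalyticFieldAt X x) :
    ∀ᶠ y in 𝓝 x, AnalyticFieldAt X y :=
  (contMDiffAt_iff_contMDiffAt_nhds (by simp)).1 hX

theorem AnalyticFieldAt.smul (hf : AnalyticFunAt f x) (hX : AnalyticFieldAt X x) :
    AnalyticFieldAt (fun y ↦ f y • X y) x := ContMDiffAt.smul_section hf hX

theorem AnalyticFieldAt.add (hX : AnalyticFieldAt X x) (hY : AnalyticFieldAt Y x) :
    AnalyticFieldAt (fun y ↦ X y + Y y) x := ContMDiffAt.add_section hX hY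

theorem AnalyticFieldAt.sub (hX : AnalyticFieldAt X x) (hY : AnalyticFieldAt Y x) :
    AnalyticFieldAt (fun y ↦ X y - Y y) x := ContMDiffAt.sub_section hX hY

theorem AnalyticFieldAt.congr (hX : AnalyticFieldAt X x) (h : Y =ᶠ[𝓝 x] X) :
    AnalyticFieldAt Y x :=
  ContMDiffAt.congr_of_eventuallyEq hX (h.mono fun y hy ↦ by simp [hy])

theorem analyticFieldAt_extendVector (v : TangentSpace (𝓡 2) x) :
    AnalyticFieldAt (extendVector v) x :=
  FiberBundle.contMDiffAt_extend (𝓡 2) (EuclideanSpace ℝ (Fin 2)) v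

theorem extendVector_self (v : TangentSpace (𝓡 2) x) : extendVector v x = v :=
  FiberBundle.extend_apply_self _ v

theorem AnalyticFieldAt.mlieBracket (hX : AnalyticFieldAt X x) (hY : AnalyticFieldAt Y x) :
    AnalyticFieldAt (mlieBracket (𝓡 2) X Y) x := by
  -- `ω + 1` reduces to `ω`, so taking brackets loses no regularity.
  have : IsManifold (𝓡 2) (ω + 1) M := inferInstanceAs (IsManifold (𝓡 2) ω M)
  have h := ContMDiffWithinAt.mlieBracketWithin_vectorField (m := ω) (n := ω)
    (contMDiffWithinAt_univ.2 hX) (contMDiffWithinAt_univ.2 hY)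
    uniqueMDiffOn_univ (Set.mem_univ x) (by simp)
  rw [contMDiffWithinAt_univ] at h
  simp only [mlieBracketWithin_univ] at h
  exact h

/-- The derivative along `X` is the fibre component of the tangent map of `f` composed with the
section `X`. The tangent map of an analytic function is again analytic. -/
theorem AnalyticFunAt.dirDeriv (hf : AnalyticFunAt f x) (hX : AnalyticFieldAt X x) :
    AnalyticFunAt (dirDeriv X f) x := by
  obtain ⟨u, hu, huo, hxu⟩ := eventually_nhds_iff.1 hf.eventually
  have h1 : ContMDiffOn (𝓡 2) 𝓘(ℝ) ω f u := fun y hy ↦ ContMDiffAt.contMDiffWithinAt (hu y hy)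
  have h2 := h1.contMDiffOn_tangentMapWithin (m := ω) le_rfl huo.uniqueMDiffOn
  have h3 := (h2 ⟨x, X x⟩ hxu).contMDiffAt
    ((huo.preimage (FiberBundle.continuous_proj (EuclideanSpace ℝ (Fin 2)) _)).mem_nhds hxu)
  have h4 := (contMDiff_snd_tangentBundle_modelSpace ℝ 𝓘(ℝ) (n := ω)).contMDiffAt.comp x
    (ContMDiffAt.comp x h3 hX)
  refine ContMDiffAt.congr_of_eventuallyEq h4 ?_
  filter_upwards [huo.mem_nhds hxu] with y hy
  exact congrArg (fun A : TangentSpace (𝓡 2) y →L[ℝ] ℝ ↦ A (X y))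
    (mfderivWithin_of_isOpen (f := f) (I := 𝓡 2) (I' := 𝓘(ℝ)) huo hy).symm

theorem dirDeriv_eq_fderiv_chart {z : EuclideanSpace ℝ (Fin 2)}
    (hz : z ∈ (extChartAt (𝓡 2) x).target) (hfz : AnalyticFunAt f ((extChartAt (𝓡 2) x).symm z)) :
    dirDeriv X f ((extChartAt (𝓡 2) x).symm z) =
      fderiv ℝ (f ∘ (extChartAt (𝓡 2) x).symm) z
        (mpullback 𝓘(ℝ, EuclideanSpace ℝ (Fin 2)) (𝓡 2) (extChartAt (𝓡 2) x).symm X z) := by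
  have hsymm : MDifferentiableAt 𝓘(ℝ, EuclideanSpace ℝ (Fin 2)) (𝓡 2)
      (extChartAt (𝓡 2) x).symm z := by
    have := (contMDiffOn_extChartAt_symm (I := 𝓡 2) (n := ω) x).contMDiffAt
      ((isOpen_extChartAt_target x).mem_nhds hz)
    exact this.mdifferentiableAt (by simp)
  have hinv : (mfderiv 𝓘(ℝ, EuclideanSpace ℝ (Fin 2)) (𝓡 2)
      (extChartAt (𝓡 2) x).symm z).IsInvertible := by
    have := isInvertible_mfderivWithin_extChartAt_symm (I := 𝓡 2) hz
    simpa using this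
  rw [← mfderiv_eq_fderiv, mfderiv_comp z hfz.mdiff hsymm]
  have := hinv.self_comp_inverse
  have h2 := congrArg (fun A ↦ A (X ((extChartAt (𝓡 2) x).symm z))) this
  exact (congrArg (fun w ↦ (mfderiv (𝓡 2) 𝓘(ℝ) f ((extChartAt (𝓡 2) x).symm z)) w) h2).symm

/-- Differentiation along the Lie bracket is the commutator of the derivations. -/
theorem dirDeriv_mlieBracket (hf : AnalyticFunAt f x) (hX : AnalyticFieldAt X x)
    (hY : AnalyticFieldAt Y x) :
    dirDeriv (mlieBracket (𝓡 2) X Y) f x =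
      dirDeriv X (dirDeriv Y f) x - dirDeriv Y (dirDeriv X f) x := by
  set φ := extChartAt (𝓡 2) x with hφ
  have hdiff : ∀ {W : ∀ x : M, TangentSpace (𝓡 2) x}, AnalyticFieldAt W x →
      DifferentiableAt ℝ (fun z : EuclideanSpace ℝ (Fin 2) ↦
        (mpullback 𝓘(ℝ, EuclideanSpace ℝ (Fin 2)) (𝓡 2) φ.symm W z : EuclideanSpace ℝ (Fin 2)))
        (φ x) := by
    intro W hW
    have := (mdifferentiableWithinAt_univ.2
      hW.mdiff).differentiableWithinAt_mpullbackWithin_vectorField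
    simp only [modelWithCornersSelf_coe, Set.range_id, mpullbackWithin_univ,
      Set.preimage_univ, Set.inter_univ] at this
    exact differentiableWithinAt_univ.1 this
  have hF : ContDiffAt ℝ ω (f ∘ φ.symm) (φ x) := by
    have h := contMDiffAt_iff.1 hf
    have h2 := h.2
    simp only [modelWithCornersSelf_coe, Set.range_id] at h2
    exact contDiffWithinAt_univ.1 h2
  have key : ∀ {W : ∀ x : M, TangentSpace (𝓡 2) x},
      (dirDeriv W f) ∘ φ.symm =ᶠ[𝓝 (φ x)] fun z ↦ fderiv ℝ (f ∘ φ.symm) z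
        (mpullback 𝓘(ℝ, EuclideanSpace ℝ (Fin 2)) (𝓡 2) φ.symm W z) := by
    intro W
    have hc : ContinuousAt φ.symm (φ x) := continuousAt_extChartAt_symm x
    have h1 : ∀ᶠ z in 𝓝 (φ x), AnalyticFunAt f (φ.symm z) := by
      apply hc.eventually
      rw [hφ, extChartAt_to_inv]
      exact hf.eventually
    filter_upwards [h1, extChartAt_target_mem_nhds (I := 𝓡 2) x] with z hz hz'
    exact dirDeriv_eq_fderiv_chart hz' hz
  have hself : ∀ W : ∀ x : M, TangentSpace (𝓡 2) x,
    mpullback 𝓘(ℝ, EuclideanSpace ℝ (Fin 2)) (𝓡 2) φ.symm W (φ x) = W x := by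
    intro W
    have h := mfderivWithin_extChartAt_symm_inverse_apply (I := 𝓡 2) (x := x)
      (W (φ.symm (φ x)))
    simp only [modelWithCornersSelf_coe, Set.range_id, mfderivWithin_univ] at h
    rw [mpullback_apply]
    refine h.trans ?_
    rw [hφ, extChartAt_to_inv]
  have hbr : (mlieBracket (𝓡 2) X Y x : EuclideanSpace ℝ (Fin 2)) = lieBracket ℝ
      (mpullback 𝓘(ℝ, EuclideanSpace ℝ (Fin 2)) (𝓡 2) φ.symm X)
      (mpullback 𝓘(ℝ, EuclideanSpace ℝ (Fin 2)) (𝓡 2) φ.symm Y) (φ x) := by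
    have hid : ∀ (A : EuclideanSpace ℝ (Fin 2) →L[ℝ] EuclideanSpace ℝ (Fin 2)),
        A = ContinuousLinearMap.id ℝ _ → ∀ v, A.inverse v = v := by
      rintro _ rfl v
      simp
    rw [mlieBracket, mlieBracketWithin_apply]
    -- The derivative of the preferred chart at its own base point is the identity, so at `x` the
    -- bracket is literally the bracket of the fields read in the chart.
    refine (hid _ mfderiv_extChartAt_self _).trans ?_
    simp only [modelWithCornersSelf_coe, Set.range_id, mpullbackWithin_univ,
      Set.preimage_univ, Set.inter_univ]
    exact congrFun lieBracketWithin_univ _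
  -- The symmetry of the second derivative enters here. The rest of the proof transports this
  -- identity from the chart to `M`.
  have e1 := fderiv_apply_lieBracket (n := ω) hF (by simp) (hdiff hY) (hdiff hX)
  have e2 : ∀ {W V : ∀ x : M, TangentSpace (𝓡 2) x}, AnalyticFieldAt W x →
     dirDeriv V (dirDeriv W f) x = fderiv ℝ (fun z ↦ fderiv ℝ (f ∘ φ.symm) z
        (mpullback 𝓘(ℝ, EuclideanSpace ℝ (Fin 2)) (𝓡 2) φ.symm W z)) (φ x)
        (mpullback 𝓘(ℝ, EuclideanSpace ℝ (Fin 2)) (𝓡 2) φ.symm V (φ x)) := by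
    intro W V hW
    rw [hself, ← key.fderiv_eq]
    exact dirDeriv_eq_fderiv_chart_self (hf.dirDeriv hW) _
  rw [e2 hY, e2 hX, ← e1, ← hbr]
  exact dirDeriv_eq_fderiv_chart_self hf _

end DirectionalDerivative

/-! ### Orthonormal frames, components and structure functions. -/

section Frame

variable {M : Type*} [TopologicalSpace M] [ChartedSpace (EuclideanSpace ℝ (Fin 2)) M]
  [IsManifold (𝓡 2) ω M]
  {X Y Z W E E₁ E₂ : ∀ x : M, TangentSpace (𝓡 2) x} {f g p q : M → ℝ} {x y : M} {U : Set M}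

theorem mlieBracket_combination (h₁ : AnalyticFieldAt E₁ y) (h₂ : AnalyticFieldAt E₂ y)
    (hf : AnalyticFunAt f y) (hg : AnalyticFunAt g y) (hp : AnalyticFunAt p y)
    (hq : AnalyticFunAt q y) :
    mlieBracket (𝓡 2) (fun y ↦ f y • E₁ y + g y • E₂ y) (fun y ↦ p y • E₁ y + q y • E₂ y) y =
      (f y * dirDeriv E₁ p y + g y * dirDeriv E₂ p y
        - p y * dirDeriv E₁ f y - q y * dirDeriv E₂ f y) • E₁ y
      + (f y * dirDeriv E₁ q y + g y * dirDeriv E₂ q y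
        - p y * dirDeriv E₁ g y - q y * dirDeriv E₂ g y) • E₂ y
      + (f y * q y - g y * p y) • mlieBracket (𝓡 2) E₁ E₂ y := by
  have : IsManifold (𝓡 2) 2 M := IsManifold.of_le (n := ω) le_top
  have k : ∀ {p q : M → ℝ} {V : ∀ x : M, TangentSpace (𝓡 2) x}, AnalyticFunAt p y →
      AnalyticFunAt q y →
      mlieBracket (𝓡 2) V (fun y ↦ p y • E₁ y + q y • E₂ y) y =
        (dirDeriv V p y • E₁ y + p y • mlieBracket (𝓡 2) V E₁ y)
          + (dirDeriv V q y • E₂ y + q y • mlieBracket (𝓡 2) V E₂ y) := by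
    intro p q V hp hq
    exact (mlieBracket_add_right (h₁.smul hp).mdiff (h₂.smul hq).mdiff).trans
      (congrArg₂ _ (mlieBracket_smul_right hp.mdiff h₁.mdiff)
        (mlieBracket_smul_right hq.mdiff h₂.mdiff))
  -- Antisymmetry turns the Leibniz rule in the right slot into the one in the left slot.
  rw [k hp hq, mlieBracket_swap_apply (V := fun y ↦ f y • E₁ y + g y • E₂ y),
    mlieBracket_swap_apply (V := fun y ↦ f y • E₁ y + g y • E₂ y), k hf hg, k hf hg,
    mlieBracket_self, mlieBracket_self, mlieBracket_swap_apply (V := E₂) (W := E₁)]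
  simp only [dirDeriv, map_add, map_smul, smul_eq_mul, Pi.zero_apply]
  module

variable [RiemannianBundle (fun x : M ↦ TangentSpace (𝓡 2) x)]

/-- `(E₁, E₂)` is a real-analytic orthonormal frame on the open set `U`. -/
structure IsOrthonormalFrame (U : Set M) (E₁ E₂ : ∀ x : M, TangentSpace (𝓡 2) x) : Prop where
  isOpen : IsOpen U
  analytic₁ : ∀ y ∈ U, AnalyticFieldAt E₁ y
  analytic₂ : ∀ y ∈ U, AnalyticFieldAt E₂ y
  inner₁₁ : ∀ y ∈ U, inner ℝ (E₁ y) (E₁ y) = 1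
  inner₂₂ : ∀ y ∈ U, inner ℝ (E₂ y) (E₂ y) = 1
  inner₁₂ : ∀ y ∈ U, inner ℝ (E₁ y) (E₂ y) = 0

/-- The component of `X` along `E`, for the Riemannian metric. -/
noncomputable def component (E X : ∀ x : M, TangentSpace (𝓡 2) x) (y : M) : ℝ :=
  inner ℝ (X y) (E y)

omit [IsManifold (𝓡 2) ω M] in
theorem component_grad : component E (grad f) = dirDeriv E f := by
  funext y
  simp [component, grad, dirDeriv]

namespace IsOrthonormalFrame

theorem mem_nhds (h : IsOrthonormalFrame U E₁ E₂) (hy : y ∈ U) : U ∈ 𝓝 y := h.isOpen.mem_nhds hy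

theorem eq_combination (h : IsOrthonormalFrame U E₁ E₂) (hy : y ∈ U) (v : TangentSpace (𝓡 2) y) :
    v = (inner ℝ v (E₁ y) : ℝ) • E₁ y + (inner ℝ v (E₂ y) : ℝ) • E₂ y := by
  have ho : Orthonormal ℝ ![E₁ y, E₂ y] := by
    rw [orthonormal_iff_ite]
    intro i j
    fin_cases i <;> fin_cases j <;>
      simp [h.inner₁₁ y hy, h.inner₂₂ y hy, h.inner₁₂ y hy, real_inner_comm (E₁ y) (E₂ y),
        - inner_self_eq_norm_sq_to_K]
  let b := (basisOfOrthonormalOfCardEqFinrank ho (by simp [finrank_tangentSpace])).toOrthonormalBasis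
    (by simpa using ho)
  have := b.sum_repr' v
  simp only [Fin.sum_univ_two] at this
  simpa [b, real_inner_comm] using this.symm

theorem field_eventuallyEq (h : IsOrthonormalFrame U E₁ E₂) (hy : y ∈ U) :
    X =ᶠ[𝓝 y] fun z ↦ component E₁ X z • E₁ z + component E₂ X z • E₂ z := by
  filter_upwards [h.mem_nhds hy] with z hz
  exact h.eq_combination hz (X z)

theorem inner_eq (h : IsOrthonormalFrame U E₁ E₂) (hy : y ∈ U) (v w : TangentSpace (𝓡 2) y) :
    inner ℝ v w = (inner ℝ v (E₁ y) : ℝ) * (inner ℝ w (E₁ y) : ℝ)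
      + (inner ℝ v (E₂ y) : ℝ) * (inner ℝ w (E₂ y) : ℝ) := by
  conv_lhs => rw [h.eq_combination hy w]
  rw [inner_add_right, inner_smul_right, inner_smul_right]
  ring

theorem inner_combination₁ (h : IsOrthonormalFrame U E₁ E₂) (hy : y ∈ U) (a b : ℝ) :
    inner ℝ (a • E₁ y + b • E₂ y) (E₁ y) = a := by
  rw [inner_add_left, inner_smul_left, inner_smul_left, h.inner₁₁ y hy,
    real_inner_comm, h.inner₁₂ y hy]
  simp

theorem inner_combination₂ (h : IsOrthonormalFrame U E₁ E₂) (hy : y ∈ U) (a b : ℝ) :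
    inner ℝ (a • E₁ y + b • E₂ y) (E₂ y) = b := by
  rw [inner_add_left, inner_smul_left, inner_smul_left, h.inner₂₂ y hy, h.inner₁₂ y hy]
  simp

theorem dirDeriv_eq (h : IsOrthonormalFrame U E₁ E₂) (hy : y ∈ U) :
    dirDeriv X f y = component E₁ X y * dirDeriv E₁ f y + component E₂ X y * dirDeriv E₂ f y := by
  have := congrArg (fun v ↦ mvfderiv (𝓡 2) f y v) (h.eq_combination hy (X y))
  simpa [dirDeriv, component] using this

theorem grad_analytic (h : IsOrthonormalFrame U E₁ E₂) (hy : y ∈ U) (hf : AnalyticFunAt f y) :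
    AnalyticFieldAt (grad f) y := by
  have h1 := h.analytic₁ y hy
  have h2 := h.analytic₂ y hy
  refine ((h1.smul (hf.dirDeriv h1)).add (h2.smul (hf.dirDeriv h2))).congr ?_
  filter_upwards [h.field_eventuallyEq hy (X := grad f)] with z hz
  rwa [component_grad, component_grad] at hz

theorem inner_grad (h : IsOrthonormalFrame U E₁ E₂) (hy : y ∈ U) :
    inner ℝ (grad f y) (grad g y) =
      dirDeriv E₁ f y * dirDeriv E₁ g y + dirDeriv E₂ f y * dirDeriv E₂ g y := by
  rw [h.inner_eq hy, ← component_grad, ← component_grad, ← component_grad, ← component_grad]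
  rfl

end IsOrthonormalFrame

variable [IsContMDiffRiemannianBundle (𝓡 2) ω (EuclideanSpace ℝ (Fin 2))
      (fun x : M ↦ TangentSpace (𝓡 2) x)]

theorem AnalyticFieldAt.inner (hX : AnalyticFieldAt X y) (hY : AnalyticFieldAt Y y) :
    AnalyticFunAt (fun z ↦ inner ℝ (X z) (Y z)) y :=
  ContMDiffAt.inner_bundle hX hY

theorem AnalyticFieldAt.component (hX : AnalyticFieldAt X y) (hY : AnalyticFieldAt Y y) :
    AnalyticFunAt (component Y X) y := hX.inner hY

/-- The component of the Lie bracket `[E₁, E₂]` along `E`. -/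
noncomputable def structureFun (E₁ E₂ E : ∀ x : M, TangentSpace (𝓡 2) x) : M → ℝ :=
  component E (mlieBracket (𝓡 2) E₁ E₂)

/-- The connection form of the frame `(E₁, E₂)`, evaluated on `X`: `⟨∇_X E₁, E₂⟩`. -/
noncomputable def connectionForm (E₁ E₂ X : ∀ x : M, TangentSpace (𝓡 2) x) (y : M) : ℝ :=
  -(component E₁ X y * structureFun E₁ E₂ E₁ y + component E₂ X y * structureFun E₁ E₂ E₂ y)

end Frame

/-! ### Connection, curvature and Laplacian in a frame. -/

section LeviCivita

variable {M : Type*} [TopologicalSpace M] [ChartedSpace (EuclideanSpace ℝ (Fin 2)) M]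
  [IsManifold (𝓡 2) ω M] [RiemannianBundle (fun x : M ↦ TangentSpace (𝓡 2) x)]
  [IsContMDiffRiemannianBundle (𝓡 2) ω (EuclideanSpace ℝ (Fin 2))
      (fun x : M ↦ TangentSpace (𝓡 2) x)]
  {X Y Z W E E₁ E₂ : ∀ x : M, TangentSpace (𝓡 2) x} {f g p q : M → ℝ} {x y : M} {U : Set M}

/-- The first component, in the frame `(E₁, E₂)`, of the covariant derivative `∇_X Z`. -/
noncomputable def covDeriv₁ (E₁ E₂ X Z : ∀ x : M, TangentSpace (𝓡 2) x) (y : M) : ℝ :=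
  dirDeriv X (component E₁ Z) y - component E₂ Z y * connectionForm E₁ E₂ X y

/-- The second component, in the frame `(E₁, E₂)`, of the covariant derivative `∇_X Z`. -/
noncomputable def covDeriv₂ (E₁ E₂ X Z : ∀ x : M, TangentSpace (𝓡 2) x) (y : M) : ℝ :=
  dirDeriv X (component E₂ Z) y + component E₁ Z y * connectionForm E₁ E₂ X y

namespace IsOrthonormalFrame

theorem component_mlieBracket (h : IsOrthonormalFrame U E₁ E₂) (hy : y ∈ U)
    (hX : AnalyticFieldAt X y) (hY : AnalyticFieldAt Y y) :
    component E₁ (mlieBracket (𝓡 2) X Y) y =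
        dirDeriv X (component E₁ Y) y - dirDeriv Y (component E₁ X) y
        + (component E₁ X y * component E₂ Y y - component E₂ X y * component E₁ Y y)
          * structureFun E₁ E₂ E₁ y ∧
      component E₂ (mlieBracket (𝓡 2) X Y) y =
        dirDeriv X (component E₂ Y) y - dirDeriv Y (component E₂ X) y
        + (component E₁ X y * component E₂ Y y - component E₂ X y * component E₁ Y y)
          * structureFun E₁ E₂ E₂ y := by
  have h1 := h.analytic₁ y hy
  have h2 := h.analytic₂ y hy
  have hb : mlieBracket (𝓡 2) X Y y = _ :=
    ((h.field_eventuallyEq hy).mlieBracket_vectorField_eq (h.field_eventuallyEq hy)).trans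
      (mlieBracket_combination h1 h2 (hX.component h1) (hX.component h2) (hY.component h1)
        (hY.component h2))
  have e1 : ∀ a b c : ℝ, ∀ v, inner ℝ (a • E₁ y + b • E₂ y + c • v) (E₁ y) =
      a + c * inner ℝ v (E₁ y) := fun a b c v ↦ by
    rw [inner_add_left, h.inner_combination₁ hy, inner_smul_left]; simp
  have e2 : ∀ a b c : ℝ, ∀ v, inner ℝ (a • E₁ y + b • E₂ y + c • v) (E₂ y) =
      b + c * inner ℝ v (E₂ y) := fun a b c v ↦ by
    rw [inner_add_left, h.inner_combination₂ hy, inner_smul_left]; simp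
  constructor
  · rw [component, hb, e1, h.dirDeriv_eq hy (X := X), h.dirDeriv_eq hy (X := Y)]
    change _ + _ * structureFun E₁ E₂ E₁ y = _
    ring
  · rw [component, hb, e2, h.dirDeriv_eq hy (X := X), h.dirDeriv_eq hy (X := Y)]
    change _ + _ * structureFun E₁ E₂ E₂ y = _
    ring

theorem dirDeriv_inner (h : IsOrthonormalFrame U E₁ E₂) (hy : y ∈ U)
    (hX : AnalyticFieldAt X y) (hY : AnalyticFieldAt Y y) :
    dirDeriv W (fun z ↦ inner ℝ (X z) (Y z)) y =
      component E₁ X y * dirDeriv W (component E₁ Y) y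
        + component E₁ Y y * dirDeriv W (component E₁ X) y
        + (component E₂ X y * dirDeriv W (component E₂ Y) y
        + component E₂ Y y * dirDeriv W (component E₂ X) y) := by
  have h1 := h.analytic₁ y hy
  have h2 := h.analytic₂ y hy
  have : (fun z ↦ inner ℝ (X z) (Y z)) =ᶠ[𝓝 y] fun z ↦
      component E₁ X z * component E₁ Y z + component E₂ X z * component E₂ Y z := by
    filter_upwards [h.mem_nhds hy] with z hz
    exact h.inner_eq hz _ _
  rw [dirDeriv_congr this, dirDeriv_add ((hX.component h1).mul (hY.component h1))
    ((hX.component h2).mul (hY.component h2)), dirDeriv_mul (hX.component h1) (hY.component h1),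
    dirDeriv_mul (hX.component h2) (hY.component h2)]

/-- Tensoriality in `W`: all derivatives of the components of `W` cancel and only its value at `y`
survives. Hence the extensions chosen inside `leviCivita` do not matter. -/
theorem koszul_eq (h : IsOrthonormalFrame U E₁ E₂) (hy : y ∈ U)
    (hX : AnalyticFieldAt X y) (hZ : AnalyticFieldAt Z y) (hW : AnalyticFieldAt W y) :
    koszul X Z W y =
      component E₁ W y * covDeriv₁ E₁ E₂ X Z y + component E₂ W y * covDeriv₂ E₁ E₂ X Z y := by
  obtain ⟨a1, a2⟩ := h.component_mlieBracket hy hX hZ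
  obtain ⟨b1, b2⟩ := h.component_mlieBracket hy hZ hW
  obtain ⟨c1, c2⟩ := h.component_mlieBracket hy hW hX
  have i : ∀ V V' : ∀ x : M, TangentSpace (𝓡 2) x, inner ℝ (V y) (V' y) =
      component E₁ V y * component E₁ V' y + component E₂ V y * component E₂ V' y :=
    fun V V' ↦ h.inner_eq hy _ _
  rw [koszul, h.dirDeriv_inner hy hZ hW, h.dirDeriv_inner hy hW hX, h.dirDeriv_inner hy hX hZ,
    i (mlieBracket (𝓡 2) X Z), i (mlieBracket (𝓡 2) Z W), i (mlieBracket (𝓡 2) W X),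
    a1, a2, b1, b2, c1, c2, covDeriv₁, covDeriv₂, connectionForm]
  ring

theorem leviCivita_eq (h : IsOrthonormalFrame U E₁ E₂) (hy : y ∈ U)
    (hX : AnalyticFieldAt X y) (hZ : AnalyticFieldAt Z y) :
    leviCivita X Z y = covDeriv₁ E₁ E₂ X Z y • E₁ y + covDeriv₂ E₁ E₂ X Z y • E₂ y := by
  rw [← (tangentBasis y).sum_repr' (covDeriv₁ E₁ E₂ X Z y • E₁ y + covDeriv₂ E₁ E₂ X Z y • E₂ y),
    leviCivita]
  refine Finset.sum_congr rfl fun i _ ↦ ?_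
  rw [h.koszul_eq hy hX hZ (analyticFieldAt_extendVector _), component, component,
    extendVector_self, inner_add_right, inner_smul_right, inner_smul_right]
  ring_nf

theorem connectionForm_analytic (h : IsOrthonormalFrame U E₁ E₂) (hy : y ∈ U)
    (hX : AnalyticFieldAt X y) : AnalyticFunAt (connectionForm E₁ E₂ X) y := by
  have h1 := h.analytic₁ y hy
  have h2 := h.analytic₂ y hy
  have hb := h1.mlieBracket h2
  exact (((hX.component h1).mul (hb.component h1)).add ((hX.component h2).mul
    (hb.component h2))).neg

theorem covDeriv₁_analytic (h : IsOrthonormalFrame U E₁ E₂) (hy : y ∈ U)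
    (hX : AnalyticFieldAt X y) (hZ : AnalyticFieldAt Z y) :
    AnalyticFunAt (covDeriv₁ E₁ E₂ X Z) y :=
  ((hZ.component (h.analytic₁ y hy)).dirDeriv hX).sub
    ((hZ.component (h.analytic₂ y hy)).mul (h.connectionForm_analytic hy hX))

theorem covDeriv₂_analytic (h : IsOrthonormalFrame U E₁ E₂) (hy : y ∈ U)
    (hX : AnalyticFieldAt X y) (hZ : AnalyticFieldAt Z y) :
    AnalyticFunAt (covDeriv₂ E₁ E₂ X Z) y :=
  ((hZ.component (h.analytic₂ y hy)).dirDeriv hX).add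
    ((hZ.component (h.analytic₁ y hy)).mul (h.connectionForm_analytic hy hX))

theorem leviCivita_eventuallyEq (h : IsOrthonormalFrame U E₁ E₂) (hy : y ∈ U)
    (hX : AnalyticFieldAt X y) (hZ : AnalyticFieldAt Z y) :
    leviCivita X Z =ᶠ[𝓝 y]
      fun z ↦ covDeriv₁ E₁ E₂ X Z z • E₁ z + covDeriv₂ E₁ E₂ X Z z • E₂ z := by
  filter_upwards [h.mem_nhds hy, hX.eventually, hZ.eventually] with z hz hXz hZz
  exact h.leviCivita_eq hz hXz hZz

theorem leviCivita_analytic (h : IsOrthonormalFrame U E₁ E₂) (hy : y ∈ U)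
    (hX : AnalyticFieldAt X y) (hZ : AnalyticFieldAt Z y) :
    AnalyticFieldAt (leviCivita X Z) y :=
  (((h.analytic₁ y hy).smul (h.covDeriv₁_analytic hy hX hZ)).add
    ((h.analytic₂ y hy).smul (h.covDeriv₂_analytic hy hX hZ))).congr
    (h.leviCivita_eventuallyEq hy hX hZ)

theorem component₁_leviCivita (h : IsOrthonormalFrame U E₁ E₂) (hy : y ∈ U)
    (hX : AnalyticFieldAt X y) (hZ : AnalyticFieldAt Z y) :
    component E₁ (leviCivita X Z) =ᶠ[𝓝 y] covDeriv₁ E₁ E₂ X Z := by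
  filter_upwards [h.mem_nhds hy, h.leviCivita_eventuallyEq hy hX hZ] with z hz e
  rw [component, e, h.inner_combination₁ hz]

theorem component₂_leviCivita (h : IsOrthonormalFrame U E₁ E₂) (hy : y ∈ U)
    (hX : AnalyticFieldAt X y) (hZ : AnalyticFieldAt Z y) :
    component E₂ (leviCivita X Z) =ᶠ[𝓝 y] covDeriv₂ E₁ E₂ X Z := by
  filter_upwards [h.mem_nhds hy, h.leviCivita_eventuallyEq hy hX hZ] with z hz e
  rw [component, e, h.inner_combination₂ hz]

/-- The curvature operator in a frame: `R(X, Y)` acts as a multiple of the rotation. -/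
theorem riemann_eq (h : IsOrthonormalFrame U E₁ E₂) (hy : y ∈ U)
    (hX : AnalyticFieldAt X y) (hY : AnalyticFieldAt Y y) (hZ : AnalyticFieldAt Z y) :
    riemann X Y Z y =
      (dirDeriv Y (connectionForm E₁ E₂ X) y - dirDeriv X (connectionForm E₁ E₂ Y) y
        + connectionForm E₁ E₂ (mlieBracket (𝓡 2) X Y) y) •
        (component E₁ Z y • E₂ y - component E₂ Z y • E₁ y) := by
  have h1 := h.analytic₁ y hy
  have h2 := h.analytic₂ y hy
  have hb := hX.mlieBracket hY
  have z1 := hZ.component h1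
  have z2 := hZ.component h2
  have wX := h.connectionForm_analytic hy hX
  have wY := h.connectionForm_analytic hy hY
  rw [riemann, h.leviCivita_eq hy hY (h.leviCivita_analytic hy hX hZ),
    h.leviCivita_eq hy hX (h.leviCivita_analytic hy hY hZ), h.leviCivita_eq hy hb hZ]
  have d1 : ∀ {V V' : ∀ x : M, TangentSpace (𝓡 2) x}, AnalyticFieldAt V y →
      dirDeriv V' (covDeriv₁ E₁ E₂ V Z) y = dirDeriv V' (dirDeriv V (component E₁ Z)) y
        - (component E₂ Z y * dirDeriv V' (connectionForm E₁ E₂ V) y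
          + connectionForm E₁ E₂ V y * dirDeriv V' (component E₂ Z) y) := by
    intro V V' hV
    have w := h.connectionForm_analytic hy hV
    exact (dirDeriv_sub (z1.dirDeriv hV) (z2.mul w)).trans (by rw [dirDeriv_mul z2 w])
  have d2 : ∀ {V V' : ∀ x : M, TangentSpace (𝓡 2) x}, AnalyticFieldAt V y →
      dirDeriv V' (covDeriv₂ E₁ E₂ V Z) y = dirDeriv V' (dirDeriv V (component E₂ Z)) y
        + (component E₁ Z y * dirDeriv V' (connectionForm E₁ E₂ V) y
          + connectionForm E₁ E₂ V y * dirDeriv V' (component E₁ Z) y) := by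
    intro V V' hV
    have w := h.connectionForm_analytic hy hV
    exact (dirDeriv_add (z2.dirDeriv hV) (z1.mul w)).trans (by rw [dirDeriv_mul z1 w])
  have l1 : ∀ {V V' : ∀ x : M, TangentSpace (𝓡 2) x}, AnalyticFieldAt V y →
      covDeriv₁ E₁ E₂ V' (leviCivita V Z) y = dirDeriv V' (covDeriv₁ E₁ E₂ V Z) y
        - covDeriv₂ E₁ E₂ V Z y * connectionForm E₁ E₂ V' y := by
    intro V V' hV
    rw [covDeriv₁, dirDeriv_congr (h.component₁_leviCivita hy hV hZ),
      (h.component₂_leviCivita hy hV hZ).eq_of_nhds]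
  have l2 : ∀ {V V' : ∀ x : M, TangentSpace (𝓡 2) x}, AnalyticFieldAt V y →
      covDeriv₂ E₁ E₂ V' (leviCivita V Z) y = dirDeriv V' (covDeriv₂ E₁ E₂ V Z) y
        + covDeriv₁ E₁ E₂ V Z y * connectionForm E₁ E₂ V' y := by
    intro V V' hV
    rw [covDeriv₂, dirDeriv_congr (h.component₂_leviCivita hy hV hZ),
      (h.component₁_leviCivita hy hV hZ).eq_of_nhds]
  rw [l1 hX, l1 hY, l2 hX, l2 hY, d1 hX, d1 hY, d2 hX, d2 hY]
  -- The bracket term absorbs the second derivatives of the components of `Z`. The first-order terms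
  -- and the products of connection forms cancel because plane rotations commute, which leaves
  -- −dω(X, Y), with ω the connection form.
  simp only [covDeriv₁, covDeriv₂, dirDeriv_mlieBracket z1 hX hY, dirDeriv_mlieBracket z2 hX hY]
  module

/-- The Gauss curvature in an orthonormal frame, from the structure functions. -/
theorem gaussCurvature_eq (h : IsOrthonormalFrame U E₁ E₂) (hy : y ∈ U) :
    gaussCurvature y = dirDeriv E₁ (structureFun E₁ E₂ E₂) y
      - dirDeriv E₂ (structureFun E₁ E₂ E₁) y
      - structureFun E₁ E₂ E₁ y ^ 2 - structureFun E₁ E₂ E₂ y ^ 2 := by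
  have h1 := h.analytic₁ y hy
  have h2 := h.analytic₂ y hy
  set X := extendVector (tangentBasis y 0) with hXd
  set Y := extendVector (tangentBasis y 1) with hYd
  have hX : AnalyticFieldAt X y := analyticFieldAt_extendVector _
  have hY : AnalyticFieldAt Y y := analyticFieldAt_extendVector _
  have eX : X y = tangentBasis y 0 := extendVector_self _
  have eY : Y y = tangentBasis y 1 := extendVector_self _
  have ho := orthonormal_iff_ite.1 (tangentBasis y).orthonormal
  have o00 : inner ℝ (X y) (X y) = (1 : ℝ) := by rw [eX, ho]; simp
  have o11 : inner ℝ (Y y) (Y y) = (1 : ℝ) := by rw [eY, ho]; simp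
  have o01 : inner ℝ (X y) (Y y) = (0 : ℝ) := by rw [eX, eY, ho]; simp
  rw [h.inner_eq hy] at o00 o11 o01
  have s1 : AnalyticFunAt (structureFun E₁ E₂ E₁) y := (h1.mlieBracket h2).component h1
  have s2 : AnalyticFunAt (structureFun E₁ E₂ E₂) y := (h1.mlieBracket h2).component h2
  have dw : ∀ {V V' : ∀ x : M, TangentSpace (𝓡 2) x}, AnalyticFieldAt V y →
      dirDeriv V' (connectionForm E₁ E₂ V) y =
        -(component E₁ V y * dirDeriv V' (structureFun E₁ E₂ E₁) y
          + structureFun E₁ E₂ E₁ y * dirDeriv V' (component E₁ V) y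
          + (component E₂ V y * dirDeriv V' (structureFun E₁ E₂ E₂) y
          + structureFun E₁ E₂ E₂ y * dirDeriv V' (component E₂ V) y)) := by
    intro V V' hV
    have v1 := hV.component h1
    have v2 := hV.component h2
    rw [← dirDeriv_mul v1 s1, ← dirDeriv_mul v2 s2, ← dirDeriv_add (v1.mul s1) (v2.mul s2),
      ← dirDeriv_neg]
    rfl
  obtain ⟨b1, b2⟩ := h.component_mlieBracket hy hX hY
  rw [gaussCurvature, ← hXd, ← hYd, h.riemann_eq hy hX hY hX, ← eY, inner_smul_left,
    inner_sub_left, inner_smul_left, inner_smul_left, real_inner_comm (Y y) (E₁ y),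
    real_inner_comm (Y y) (E₂ y), dw hX, dw hY,
    h.dirDeriv_eq hy (X := X) (f := structureFun E₁ E₂ E₁),
    h.dirDeriv_eq hy (X := X) (f := structureFun E₁ E₂ E₂),
    h.dirDeriv_eq hy (X := Y) (f := structureFun E₁ E₂ E₁),
    h.dirDeriv_eq hy (X := Y) (f := structureFun E₁ E₂ E₂)]
  unfold connectionForm
  rw [b1, b2]
  unfold component
  simp only [conj_trivial]
  set x1 : ℝ := inner ℝ (X y) (E₁ y)
  set x2 : ℝ := inner ℝ (X y) (E₂ y)
  set y1 : ℝ := inner ℝ (Y y) (E₁ y)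
  set y2 : ℝ := inner ℝ (Y y) (E₂ y)
  -- The change of basis from the frame to `tangentBasis y` is orthogonal. Its determinant ±1 enters
  -- the curvature squared, so orientation plays no role.
  have hdet : (x1 * y2 - x2 * y1) ^ 2 = 1 := by
    linear_combination (y1 * y1 + y2 * y2) * o00 + o11 - (x1 * y1 + x2 * y2) * o01
  linear_combination (dirDeriv E₁ (structureFun E₁ E₂ E₂) y
      - dirDeriv E₂ (structureFun E₁ E₂ E₁) y
      - structureFun E₁ E₂ E₁ y ^ 2 - structureFun E₁ E₂ E₂ y ^ 2) * hdet

/-- The definition of `gaussCurvature` picks a basis at each point with no regularity in the point.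
Analyticity comes only from the frame formula. -/
theorem gaussCurvature_analytic (h : IsOrthonormalFrame U E₁ E₂) (hy : y ∈ U) :
    AnalyticFunAt (gaussCurvature (M := M)) y := by
  have h1 := h.analytic₁ y hy
  have h2 := h.analytic₂ y hy
  have s1 : AnalyticFunAt (structureFun E₁ E₂ E₁) y := (h1.mlieBracket h2).component h1
  have s2 : AnalyticFunAt (structureFun E₁ E₂ E₂) y := (h1.mlieBracket h2).component h2
  refine ((((s2.dirDeriv h1).sub (s1.dirDeriv h2)).sub (s1.pow 2)).sub (s2.pow 2)).congr ?_
  filter_upwards [h.mem_nhds hy] with z hz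
  exact h.gaussCurvature_eq hz

end IsOrthonormalFrame

namespace IsOrthonormalFrame

/-- The Laplace-Beltrami operator in an orthonormal frame. -/
theorem laplacian_eq (h : IsOrthonormalFrame U E₁ E₂) (hy : y ∈ U) (hf : AnalyticFunAt f y) :
    laplacian f y = dirDeriv E₁ (dirDeriv E₁ f) y + dirDeriv E₂ (dirDeriv E₂ f) y
      + structureFun E₁ E₂ E₁ y * dirDeriv E₂ f y
      - structureFun E₁ E₂ E₂ y * dirDeriv E₁ f y := by
  have hg := h.grad_analytic hy hf
  have e : ∀ i, hessian f y (tangentBasis y i) (tangentBasis y i) =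
      (inner ℝ (E₁ y) (tangentBasis y i) : ℝ) * inner ℝ (tangentBasis y i) (E₁ y)
        * (dirDeriv E₁ (dirDeriv E₁ f) y + structureFun E₁ E₂ E₁ y * dirDeriv E₂ f y)
      + (inner ℝ (E₂ y) (tangentBasis y i) : ℝ) * inner ℝ (tangentBasis y i) (E₂ y)
        * (dirDeriv E₂ (dirDeriv E₂ f) y - structureFun E₁ E₂ E₂ y * dirDeriv E₁ f y)
      + (inner ℝ (E₁ y) (tangentBasis y i) : ℝ) * inner ℝ (tangentBasis y i) (E₂ y)
        * (dirDeriv E₂ (dirDeriv E₁ f) y + dirDeriv E₁ (dirDeriv E₂ f) y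
          + structureFun E₁ E₂ E₂ y * dirDeriv E₂ f y
          - structureFun E₁ E₂ E₁ y * dirDeriv E₁ f y) := by
    intro i
    rw [hessian, h.leviCivita_eq hy (analyticFieldAt_extendVector _) hg, covDeriv₁, covDeriv₂,
      component_grad, component_grad, h.dirDeriv_eq hy, h.dirDeriv_eq hy (f := dirDeriv E₂ f),
      connectionForm, component, component, extendVector_self, inner_add_right, inner_smul_right,
      inner_smul_right, real_inner_comm (tangentBasis y i) (E₁ y),
      real_inner_comm (tangentBasis y i) (E₂ y)]
    ring
  simp only [laplacian, e]
  -- Parseval's identity over `tangentBasis y` turns the three sums into ⟨E₁, E₁⟩ = 1, ⟨E₂, E₂⟩ = 1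
  -- and ⟨E₁, E₂⟩ = 0, so the mixed Hessian term drops out.
  rw [Finset.sum_add_distrib, Finset.sum_add_distrib, ← Finset.sum_mul, ← Finset.sum_mul,
    ← Finset.sum_mul, OrthonormalBasis.sum_inner_mul_inner, OrthonormalBasis.sum_inner_mul_inner,
    OrthonormalBasis.sum_inner_mul_inner, h.inner₁₁ y hy, h.inner₂₂ y hy, h.inner₁₂ y hy]
  ring

end IsOrthonormalFrame

end LeviCivita

/-! ### Existence of local analytic orthonormal frames. -/

section Existence

variable {M : Type*} [TopologicalSpace M] [ChartedSpace (EuclideanSpace ℝ (Fin 2)) M]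

theorem AnalyticFunAt.inv_sqrt {f : M → ℝ} {x : M} (hf : AnalyticFunAt f x) (h : 0 < f x) :
    AnalyticFunAt (fun y ↦ (√(f y))⁻¹) x := by
  have h1 : ContDiffAt ℝ ω (fun t : ℝ ↦ (√t)⁻¹) (f x) :=
    (Real.contDiffAt_sqrt h.ne').inv (Real.sqrt_ne_zero'.2 h)
  exact ContMDiffAt.comp (g := fun t : ℝ ↦ (√t)⁻¹) x h1.contMDiffAt hf

variable [IsManifold (𝓡 2) ω M] [RiemannianBundle (fun x : M ↦ TangentSpace (𝓡 2) x)]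
  [IsContMDiffRiemannianBundle (𝓡 2) ω (EuclideanSpace ℝ (Fin 2))
      (fun x : M ↦ TangentSpace (𝓡 2) x)]

/-- Gram-Schmidt orthonormalization: every point has a neighbourhood carrying a real-analytic
orthonormal frame. -/
theorem exists_isOrthonormalFrame (x : M) :
    ∃ (U : Set M) (E₁ E₂ : ∀ x : M, TangentSpace (𝓡 2) x), x ∈ U ∧ IsOrthonormalFrame U E₁ E₂ := by
  set X := extendVector (tangentBasis x 0) with hXd
  set Y := extendVector (tangentBasis x 1) with hYd
  have hX : AnalyticFieldAt X x := analyticFieldAt_extendVector _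
  have hY : AnalyticFieldAt Y x := analyticFieldAt_extendVector _
  have eX : X x = tangentBasis x 0 := extendVector_self _
  have eY : Y x = tangentBasis x 1 := extendVector_self _
  have ho := orthonormal_iff_ite.1 (tangentBasis x).orthonormal
  set a : M → ℝ := fun z ↦ inner ℝ (X z) (X z) with ha
  set b : M → ℝ := fun z ↦ inner ℝ (X z) (Y z) with hb
  set d : M → ℝ := fun z ↦ inner ℝ (Y z) (Y z) with hd
  have ax : a x = 1 := by simp only [ha]; rw [eX, ho]; simp
  have bx : b x = 0 := by simp only [hb]; rw [eX, eY, ho]; simp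
  have dx : d x = 1 := by simp only [hd]; rw [eY, ho]; simp
  have haA : AnalyticFunAt a x := hX.inner hX
  have hbA : AnalyticFunAt b x := hX.inner hY
  have hdA : AnalyticFunAt d x := hY.inner hY
  -- The function a(ad − b²) is the squared norm of aY − bX, a multiple of the Gram-Schmidt vector
  -- that avoids dividing by a. It equals 1 at `x`, where the Gram matrix is the identity.
  have hgA : AnalyticFunAt (fun z ↦ a z * (a z * d z - b z * b z)) x :=
    haA.mul ((haA.mul hdA).sub (hbA.mul hbA))
  have pos1 : ∀ᶠ z in 𝓝 x, 0 < a z := haA.continuousAt.eventually (lt_mem_nhds (by simp [ax]))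
  have pos2 : ∀ᶠ z in 𝓝 x, 0 < a z * (a z * d z - b z * b z) :=
    hgA.continuousAt.eventually (lt_mem_nhds (by simp [ax, bx, dx]))
  obtain ⟨U, hU, hUo, hxU⟩ := eventually_nhds_iff.1
    (hX.eventually.and (hY.eventually.and (pos1.and pos2)))
  refine ⟨U, fun z ↦ (√(a z))⁻¹ • X z,
    fun z ↦ (√(a z * (a z * d z - b z * b z)))⁻¹ • (a z • Y z - b z • X z), hxU, hUo, ?_, ?_, ?_,
    ?_, ?_⟩
  · intro y hy
    obtain ⟨h1, -, h3, -⟩ := hU y hy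
    exact h1.smul ((h1.inner h1).inv_sqrt h3)
  · intro y hy
    obtain ⟨h1, h2, -, h4⟩ := hU y hy
    have ya : AnalyticFunAt a y := h1.inner h1
    have yb : AnalyticFunAt b y := h1.inner h2
    have yd : AnalyticFunAt d y := h2.inner h2
    exact ((h2.smul ya).sub (h1.smul yb)).smul
      ((ya.mul ((ya.mul yd).sub (yb.mul yb))).inv_sqrt h4)
  · intro y hy
    obtain ⟨-, -, h3, -⟩ := hU y hy
    simp only [inner_smul_left, inner_smul_right, conj_trivial]
    change (√(a y))⁻¹ * ((√(a y))⁻¹ * a y) = 1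
    rw [← mul_assoc, ← mul_inv, Real.mul_self_sqrt h3.le, inv_mul_cancel₀ h3.ne']
  · intro y hy
    obtain ⟨-, -, -, h4⟩ := hU y hy
    simp only [inner_smul_left, inner_smul_right, inner_sub_left, inner_sub_right, conj_trivial]
    rw [real_inner_comm (X y) (Y y)]
    set s := √(a y * (a y * d y - b y * b y)) with hs
    have hss : s * s = a y * (a y * d y - b y * b y) := Real.mul_self_sqrt h4.le
    have hs0 : s ≠ 0 := (Real.sqrt_pos.2 h4).ne'
    change s⁻¹ * (a y * (s⁻¹ * (a y * d y - b y * b y)) - b y * (s⁻¹ * (a y * b y - b y * a y))) = 1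
    field_simp
    linear_combination -hss
  · intro y hy
    simp only [inner_smul_left, inner_smul_right, inner_sub_right, conj_trivial]
    change _ * (a y * (_ * b y) - b y * (_ * a y)) = 0
    ring

end Existence

/-! ### Bochner's formula, and the algebraic elimination of the Hessian. -/

section Bochner

variable {M : Type*} [TopologicalSpace M] [ChartedSpace (EuclideanSpace ℝ (Fin 2)) M]
  [IsManifold (𝓡 2) ω M] [RiemannianBundle (fun x : M ↦ TangentSpace (𝓡 2) x)]
  [IsContMDiffRiemannianBundle (𝓡 2) ω (EuclideanSpace ℝ (Fin 2))
      (fun x : M ↦ TangentSpace (𝓡 2) x)]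
  {E E₁ E₂ : ∀ x : M, TangentSpace (𝓡 2) x} {f g : M → ℝ} {x y : M} {U : Set M}

/-- The entry `⟨∇_{E₁} ∇f, E₁⟩` of the Hessian in a frame. -/
noncomputable def hessian₁₁ (E₁ E₂ : ∀ x : M, TangentSpace (𝓡 2) x) (f : M → ℝ) (y : M) : ℝ :=
  dirDeriv E₁ (dirDeriv E₁ f) y + structureFun E₁ E₂ E₁ y * dirDeriv E₂ f y

/-- The entry `⟨∇_{E₁} ∇f, E₂⟩` of the Hessian in a frame. -/
noncomputable def hessian₁₂ (E₁ E₂ : ∀ x : M, TangentSpace (𝓡 2) x) (f : M → ℝ) (y : M) : ℝ :=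
  dirDeriv E₁ (dirDeriv E₂ f) y - structureFun E₁ E₂ E₁ y * dirDeriv E₁ f y

/-- The entry `⟨∇_{E₂} ∇f, E₂⟩` of the Hessian in a frame. -/
noncomputable def hessian₂₂ (E₁ E₂ : ∀ x : M, TangentSpace (𝓡 2) x) (f : M → ℝ) (y : M) : ℝ :=
  dirDeriv E₂ (dirDeriv E₂ f) y - structureFun E₁ E₂ E₂ y * dirDeriv E₁ f y

namespace IsOrthonormalFrame

theorem structureFun₁_analytic (h : IsOrthonormalFrame U E₁ E₂) (hy : y ∈ U) :
    AnalyticFunAt (structureFun E₁ E₂ E₁) y :=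
  ((h.analytic₁ y hy).mlieBracket (h.analytic₂ y hy)).component (h.analytic₁ y hy)

theorem structureFun₂_analytic (h : IsOrthonormalFrame U E₁ E₂) (hy : y ∈ U) :
    AnalyticFunAt (structureFun E₁ E₂ E₂) y :=
  ((h.analytic₁ y hy).mlieBracket (h.analytic₂ y hy)).component (h.analytic₂ y hy)

theorem laplacian_eq_hessian (h : IsOrthonormalFrame U E₁ E₂) (hy : y ∈ U)
    (hf : AnalyticFunAt f y) :
    laplacian f y = hessian₁₁ E₁ E₂ f y + hessian₂₂ E₁ E₂ f y := by
  rw [h.laplacian_eq hy hf, hessian₁₁, hessian₂₂]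
  ring

theorem laplacian_eventuallyEq (h : IsOrthonormalFrame U E₁ E₂) (hy : y ∈ U)
    (hf : AnalyticFunAt f y) :
    laplacian f =ᶠ[𝓝 y] fun z ↦ dirDeriv E₁ (dirDeriv E₁ f) z + dirDeriv E₂ (dirDeriv E₂ f) z
      + structureFun E₁ E₂ E₁ z * dirDeriv E₂ f z
      - structureFun E₁ E₂ E₂ z * dirDeriv E₁ f z := by
  filter_upwards [h.mem_nhds hy, hf.eventually] with z hz hfz
  exact h.laplacian_eq hz hfz

theorem laplacian_analytic (h : IsOrthonormalFrame U E₁ E₂) (hy : y ∈ U)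
    (hf : AnalyticFunAt f y) : AnalyticFunAt (laplacian f) y := by
  have h1 := h.analytic₁ y hy
  have h2 := h.analytic₂ y hy
  exact (((((hf.dirDeriv h1).dirDeriv h1).add ((hf.dirDeriv h2).dirDeriv h2)).add
    ((h.structureFun₁_analytic hy).mul (hf.dirDeriv h2))).sub
    ((h.structureFun₂_analytic hy).mul (hf.dirDeriv h1))).congr (h.laplacian_eventuallyEq hy hf)

omit [IsContMDiffRiemannianBundle (𝓡 2) ω (EuclideanSpace ℝ (Fin 2))
      (fun x : M ↦ TangentSpace (𝓡 2) x)] in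
/-- The commutator of the frame derivatives. -/
theorem commutator (h : IsOrthonormalFrame U E₁ E₂) (hy : y ∈ U) (hf : AnalyticFunAt f y) :
    dirDeriv E₁ (dirDeriv E₂ f) y - dirDeriv E₂ (dirDeriv E₁ f) y =
      structureFun E₁ E₂ E₁ y * dirDeriv E₁ f y + structureFun E₁ E₂ E₂ y * dirDeriv E₂ f y := by
  rw [← dirDeriv_mlieBracket hf (h.analytic₁ y hy) (h.analytic₂ y hy), h.dirDeriv_eq hy]
  rfl

/-- The commutator relation holds on a neighbourhood, so it may be differentiated. This supplies the
third-order relations needed for `bochner`. -/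
theorem dirDeriv_commutator (h : IsOrthonormalFrame U E₁ E₂) (hy : y ∈ U)
    (hf : AnalyticFunAt f y) :
    dirDeriv E (dirDeriv E₁ (dirDeriv E₂ f)) y - dirDeriv E (dirDeriv E₂ (dirDeriv E₁ f)) y =
      structureFun E₁ E₂ E₁ y * dirDeriv E (dirDeriv E₁ f) y
        + dirDeriv E₁ f y * dirDeriv E (structureFun E₁ E₂ E₁) y
        + (structureFun E₁ E₂ E₂ y * dirDeriv E (dirDeriv E₂ f) y
        + dirDeriv E₂ f y * dirDeriv E (structureFun E₁ E₂ E₂) y) := by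
  have h1 := h.analytic₁ y hy
  have h2 := h.analytic₂ y hy
  have s1 := h.structureFun₁_analytic hy
  have s2 := h.structureFun₂_analytic hy
  have n1 := hf.dirDeriv h1
  have n2 := hf.dirDeriv h2
  have e : (fun z ↦ dirDeriv E₁ (dirDeriv E₂ f) z - dirDeriv E₂ (dirDeriv E₁ f) z) =ᶠ[𝓝 y]
      fun z ↦ structureFun E₁ E₂ E₁ z * dirDeriv E₁ f z
        + structureFun E₁ E₂ E₂ z * dirDeriv E₂ f z := by
    filter_upwards [h.mem_nhds hy, hf.eventually] with z hz hfz
    exact h.commutator hz hfz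
  rw [← dirDeriv_sub (n2.dirDeriv h1) (n1.dirDeriv h2), dirDeriv_congr e,
    dirDeriv_add (s1.mul n1) (s2.mul n2), dirDeriv_mul s1 n1, dirDeriv_mul s2 n2]

theorem laplacian_mul (h : IsOrthonormalFrame U E₁ E₂) (hy : y ∈ U)
    (hf : AnalyticFunAt f y) (hg : AnalyticFunAt g y) :
    laplacian (fun z ↦ f z * g z) y = f y * laplacian g y + g y * laplacian f y
      + 2 * (dirDeriv E₁ f y * dirDeriv E₁ g y + dirDeriv E₂ f y * dirDeriv E₂ g y) := by
  have h1 := h.analytic₁ y hy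
  have h2 := h.analytic₂ y hy
  have dd : ∀ {E : ∀ x : M, TangentSpace (𝓡 2) x}, AnalyticFieldAt E y →
      dirDeriv E (dirDeriv E fun z ↦ f z * g z) y = f y * dirDeriv E (dirDeriv E g) y
        + g y * dirDeriv E (dirDeriv E f) y + 2 * (dirDeriv E f y * dirDeriv E g y) := by
    intro E hE
    have e : dirDeriv E (fun z ↦ f z * g z) =ᶠ[𝓝 y] fun z ↦
        f z * dirDeriv E g z + g z * dirDeriv E f z := by
      filter_upwards [hf.eventually, hg.eventually] with z hfz hgz
      exact dirDeriv_mul hfz hgz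
    rw [dirDeriv_congr e, dirDeriv_add (hf.mul (hg.dirDeriv hE)) (hg.mul (hf.dirDeriv hE)),
      dirDeriv_mul hf (hg.dirDeriv hE), dirDeriv_mul hg (hf.dirDeriv hE)]
    ring
  rw [h.laplacian_eq hy (hf.mul hg), dd h1, dd h2, dirDeriv_mul hf hg, dirDeriv_mul hf hg,
    h.laplacian_eq hy hf, h.laplacian_eq hy hg]
  ring

theorem laplacian_add (h : IsOrthonormalFrame U E₁ E₂) (hy : y ∈ U)
    (hf : AnalyticFunAt f y) (hg : AnalyticFunAt g y) :
    laplacian (fun z ↦ f z + g z) y = laplacian f y + laplacian g y := by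
  have h1 := h.analytic₁ y hy
  have h2 := h.analytic₂ y hy
  have dd : ∀ {E : ∀ x : M, TangentSpace (𝓡 2) x}, AnalyticFieldAt E y →
      dirDeriv E (dirDeriv E fun z ↦ f z + g z) y =
        dirDeriv E (dirDeriv E f) y + dirDeriv E (dirDeriv E g) y := by
    intro E hE
    have e : dirDeriv E (fun z ↦ f z + g z) =ᶠ[𝓝 y] fun z ↦ dirDeriv E f z + dirDeriv E g z := by
      filter_upwards [hf.eventually, hg.eventually] with z hfz hgz
      exact dirDeriv_add hfz hgz
    rw [dirDeriv_congr e, dirDeriv_add (hf.dirDeriv hE) (hg.dirDeriv hE)]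
  rw [h.laplacian_eq hy (hf.add hg), dd h1, dd h2, dirDeriv_add hf hg, dirDeriv_add hf hg,
    h.laplacian_eq hy hf, h.laplacian_eq hy hg]
  ring

theorem laplacian_const (h : IsOrthonormalFrame U E₁ E₂) (hy : y ∈ U) (c : ℝ) :
    laplacian (fun _ : M ↦ c) y = 0 := by
  have e : ∀ E : ∀ x : M, TangentSpace (𝓡 2) x, dirDeriv E (fun _ : M ↦ c) = fun _ ↦ 0 :=
    fun E ↦ funext fun z ↦ dirDeriv_const c
  rw [h.laplacian_eq hy (AnalyticFunAt.const c), e, e, dirDeriv_const, dirDeriv_const]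
  ring

omit [IsContMDiffRiemannianBundle (𝓡 2) ω (EuclideanSpace ℝ (Fin 2))
      (fun x : M ↦ TangentSpace (𝓡 2) x)] in
/-- The derivative of `‖∇f‖²` along `E₁` is `2 ∇²f(∇f, E₁)`. -/
theorem dirDeriv₁_norm_sq (h : IsOrthonormalFrame U E₁ E₂) (hy : y ∈ U)
    (hf : AnalyticFunAt f y) :
    dirDeriv E₁ (fun z ↦ dirDeriv E₁ f z * dirDeriv E₁ f z + dirDeriv E₂ f z * dirDeriv E₂ f z) y =
      2 * (dirDeriv E₁ f y * hessian₁₁ E₁ E₂ f y + dirDeriv E₂ f y * hessian₁₂ E₁ E₂ f y) := by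
  have n1 := hf.dirDeriv (h.analytic₁ y hy)
  have n2 := hf.dirDeriv (h.analytic₂ y hy)
  rw [dirDeriv_add (n1.mul n1) (n2.mul n2), dirDeriv_mul n1 n1, dirDeriv_mul n2 n2, hessian₁₁,
    hessian₁₂]
  ring

omit [IsContMDiffRiemannianBundle (𝓡 2) ω (EuclideanSpace ℝ (Fin 2))
      (fun x : M ↦ TangentSpace (𝓡 2) x)] in
/-- The derivative of `‖∇f‖²` along `E₂` is `2 ∇²f(∇f, E₂)`. -/
theorem dirDeriv₂_norm_sq (h : IsOrthonormalFrame U E₁ E₂) (hy : y ∈ U)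
    (hf : AnalyticFunAt f y) :
    dirDeriv E₂ (fun z ↦ dirDeriv E₁ f z * dirDeriv E₁ f z + dirDeriv E₂ f z * dirDeriv E₂ f z) y =
      2 * (dirDeriv E₁ f y * hessian₁₂ E₁ E₂ f y + dirDeriv E₂ f y * hessian₂₂ E₁ E₂ f y) := by
  have n1 := hf.dirDeriv (h.analytic₁ y hy)
  have n2 := hf.dirDeriv (h.analytic₂ y hy)
  rw [dirDeriv_add (n1.mul n1) (n2.mul n2), dirDeriv_mul n1 n1, dirDeriv_mul n2 n2, hessian₁₂,
    hessian₂₂]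
  -- The entry `hessian₁₂` is defined through E₁E₂f, while E₂E₁f appears here. The commutator
  -- relation is exactly the symmetry of the Hessian.
  linear_combination (-2 * dirDeriv E₁ f y) * h.commutator hy hf

/-- Bochner's formula on a surface. -/
theorem bochner (h : IsOrthonormalFrame U E₁ E₂) (hy : y ∈ U) (hf : AnalyticFunAt f y) :
    laplacian (fun z ↦ dirDeriv E₁ f z * dirDeriv E₁ f z + dirDeriv E₂ f z * dirDeriv E₂ f z) y =
      2 * (hessian₁₁ E₁ E₂ f y ^ 2 + 2 * hessian₁₂ E₁ E₂ f y ^ 2 + hessian₂₂ E₁ E₂ f y ^ 2)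
      + 2 * (dirDeriv E₁ f y * dirDeriv E₁ (laplacian f) y
        + dirDeriv E₂ f y * dirDeriv E₂ (laplacian f) y)
      + 2 * gaussCurvature y * (dirDeriv E₁ f y ^ 2 + dirDeriv E₂ f y ^ 2) := by
  have h1 := h.analytic₁ y hy
  have h2 := h.analytic₂ y hy
  have s1 := h.structureFun₁_analytic hy
  have s2 := h.structureFun₂_analytic hy
  have n1 := hf.dirDeriv h1
  have n2 := hf.dirDeriv h2
  have dL : ∀ E : ∀ x : M, TangentSpace (𝓡 2) x, dirDeriv E (laplacian f) y =
      dirDeriv E (dirDeriv E₁ (dirDeriv E₁ f)) y + dirDeriv E (dirDeriv E₂ (dirDeriv E₂ f)) y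
      + (structureFun E₁ E₂ E₁ y * dirDeriv E (dirDeriv E₂ f) y
        + dirDeriv E₂ f y * dirDeriv E (structureFun E₁ E₂ E₁) y)
      - (structureFun E₁ E₂ E₂ y * dirDeriv E (dirDeriv E₁ f) y
        + dirDeriv E₁ f y * dirDeriv E (structureFun E₁ E₂ E₂) y) := by
    intro E
    rw [dirDeriv_congr (h.laplacian_eventuallyEq hy hf),
      dirDeriv_sub (((n1.dirDeriv h1).add (n2.dirDeriv h2)).add (s1.mul n2)) (s2.mul n1),
      dirDeriv_add ((n1.dirDeriv h1).add (n2.dirDeriv h2)) (s1.mul n2),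
      dirDeriv_add (n1.dirDeriv h1) (n2.dirDeriv h2), dirDeriv_mul s1 n2, dirDeriv_mul s2 n1]
  have c0 := h.commutator hy hf
  have c1 := h.commutator hy n1
  have c2 := h.commutator hy n2
  have t1 := h.dirDeriv_commutator (E := E₁) hy hf
  have t2 := h.dirDeriv_commutator (E := E₂) hy hf
  rw [h.laplacian_add hy (n1.mul n1) (n2.mul n2), h.laplacian_mul hy n1 n1,
    h.laplacian_mul hy n2 n2, h.laplacian_eq hy n1, h.laplacian_eq hy n2, dL, dL,
    h.gaussCurvature_eq hy, hessian₁₁, hessian₁₂, hessian₂₂]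
  -- The sum `c2 + t2` telescopes to the commutator of E₁ with E₂E₂, and `t1 + c1` to that of E₁E₁
  -- with E₂, both applied to `f`. The derivatives of the structure functions in `t1` and `t2`, with
  -- those in the derivatives of Δf, account for the curvature term. The relation `c0` handles the
  -- remaining mixed second derivatives.
  linear_combination (-2 * dirDeriv E₁ f y) * (c2 + t2) + (2 * dirDeriv E₂ f y) * (t1 + c1)
    - (2 * (dirDeriv E₂ (dirDeriv E₁ f) y + dirDeriv E₁ (dirDeriv E₂ f) y
      - structureFun E₁ E₂ E₁ y * dirDeriv E₁ f y - structureFun E₁ E₂ E₂ y * dirDeriv E₂ f y)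
      + 4 * dirDeriv E₂ f y * structureFun E₁ E₂ E₂ y) * c0

end IsOrthonormalFrame

/-- Pure algebra at one point: `v` is ν, (`n1`, `n2`) is ∇ν, (`k1`, `k2`) is ∇K, `h11`, `h12`, `h22`
are the Hessian entries of ν, and `L` is ΔK. `F0` is the gradient hypothesis, `F1` and `F2` its
derivatives along the frame, `F3` the Laplace equation and `F4` Bochner's formula. -/
theorem curvature_identity_of_frame (v n1 n2 K k1 k2 c h11 h12 h22 L : ℝ)
    (F0 : n1 ^ 2 + n2 ^ 2 = (v ^ 2 - 1) * (K - c * v ^ 2))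
    (F1 : 2 * (n1 * h11 + n2 * h12) =
      2 * v * n1 * (K - c * v ^ 2) + (v ^ 2 - 1) * (k1 - 2 * c * v * n1))
    (F2 : 2 * (n1 * h12 + n2 * h22) =
      2 * v * n2 * (K - c * v ^ 2) + (v ^ 2 - 1) * (k2 - 2 * c * v * n2))
    (F3 : h11 + h22 = 2 * K * v - c * (1 + v ^ 2) * v)
    (F4 : (v ^ 2 - 1) * (L - c * (2 * (n1 ^ 2 + n2 ^ 2) + 2 * v * (2 * K * v - c * (1 + v ^ 2) * v)))
      + (K - c * v ^ 2) * (2 * (n1 ^ 2 + n2 ^ 2) + 2 * v * (2 * K * v - c * (1 + v ^ 2) * v))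
      + 4 * v * (n1 * k1 + n2 * k2 - 2 * c * v * (n1 ^ 2 + n2 ^ 2)) =
      2 * (h11 ^ 2 + 2 * h12 ^ 2 + h22 ^ 2)
      + 2 * (n1 * (2 * K * n1 + 2 * v * k1 - c * (1 + 3 * v ^ 2) * n1)
        + n2 * (2 * K * n2 + 2 * v * k2 - c * (1 + 3 * v ^ 2) * n2))
      + 2 * K * (n1 ^ 2 + n2 ^ 2)) :
    (1 - v ^ 2) ^ 2 * (k1 ^ 2 + k2 ^ 2 - (K - c * v ^ 2) * L
      + 4 * (K - c) * (K - c * v ^ 2) * (K + 2 * c * v ^ 2)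
      - 6 * c * v * (n1 * k1 + n2 * k2)) = 0 := by
  set b := 2 * K * v - c * (1 + v ^ 2) * v with hb
  set A := (v ^ 2 - 1) * (K - c * v ^ 2) with hA
  set q := 2 * v * (K - c * v ^ 2) - 2 * c * v * (v ^ 2 - 1) with hq
  -- Cayley–Hamilton for the symmetric matrix H with trace `b`, evaluated on ∇ν, where `A` = ‖∇ν‖².
  -- By `F1` and `F2`, H∇ν = (q∇ν + (v² − 1)∇K)/2.
  have CH : A * (h11 ^ 2 + 2 * h12 ^ 2 + h22 ^ 2) = A * b ^ 2
      + 2 * (((q * n1 + (v ^ 2 - 1) * k1) / 2) ^ 2 + ((q * n2 + (v ^ 2 - 1) * k2) / 2) ^ 2)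
      - 2 * b * (n1 * ((q * n1 + (v ^ 2 - 1) * k1) / 2)
        + n2 * ((q * n2 + (v ^ 2 - 1) * k2) / 2)) := by
    have m1 : (q * n1 + (v ^ 2 - 1) * k1) / 2 = n1 * h11 + n2 * h12 := by
      rw [hq]; linear_combination (-1 / 2) * F1
    have m2 : (q * n2 + (v ^ 2 - 1) * k2) / 2 = n1 * h12 + n2 * h22 := by
      rw [hq]; linear_combination (-1 / 2) * F2
    rw [m1, m2, ← F3, ← F0]
    ring
  -- Bochner's formula is multiplied by `A` and `CH` removes the Hessian. The coefficient of `F0`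
  -- gathers the occurrences of ‖∇ν‖², each replaced by `A`.
  linear_combination (-A) * F4 - 2 * CH
    + (A * (-2 * c * (v ^ 2 - 1) + 2 * (K - c * v ^ 2) - 8 * c * v ^ 2)
      - q ^ 2 + 2 * b * q - 2 * A * (2 * K - c * (1 + 3 * v ^ 2)) - 2 * A * K) * F0

end Bochner

/-! ### The curvature identity up to the factor (1 − ν²)², and the case ν² = 1. -/

section CurvatureIdentity

variable {M : Type*} [TopologicalSpace M] [ChartedSpace (EuclideanSpace ℝ (Fin 2)) M]
  [IsManifold (𝓡 2) ω M] [RiemannianBundle (fun x : M ↦ TangentSpace (𝓡 2) x)]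
  [IsContMDiffRiemannianBundle (𝓡 2) ω (EuclideanSpace ℝ (Fin 2))
      (fun x : M ↦ TangentSpace (𝓡 2) x)]
  {E₁ E₂ : ∀ x : M, TangentSpace (𝓡 2) x} {y : M} {U : Set M}

/-- The defect of the curvature identity: its right-hand side minus its left-hand side. -/
noncomputable def curvatureDefect (c : ℝ) (ν : M → ℝ) (y : M) : ℝ :=
  inner ℝ (grad gaussCurvature y) (grad gaussCurvature y)
    - (gaussCurvature y - c * ν y ^ 2) * laplacian gaussCurvature y
    + 4 * (gaussCurvature y - c) * (gaussCurvature y - c * ν y ^ 2)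
      * (gaussCurvature y + 2 * c * ν y ^ 2)
    - 6 * c * ν y * inner ℝ (grad ν y) (grad gaussCurvature y)

namespace IsOrthonormalFrame

theorem curvatureDefect_analytic (h : IsOrthonormalFrame U E₁ E₂) (hy : y ∈ U) (c : ℝ)
    {ν : M → ℝ} (hν : AnalyticFunAt ν y) : AnalyticFunAt (curvatureDefect c ν) y := by
  have hK := h.gaussCurvature_analytic hy
  have gK := h.grad_analytic hy hK
  have hc : ∀ r : ℝ, AnalyticFunAt (fun _ : M ↦ r) y := AnalyticFunAt.const
  have hv := (hc c).mul (hν.pow 2)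
  exact (((gK.inner gK).sub ((hK.sub hv).mul (h.laplacian_analytic hy hK))).add
    ((((hc 4).mul (hK.sub (hc c))).mul (hK.sub hv)).mul
      (hK.add (((hc 2).mul (hc c)).mul (hν.pow 2))))).sub
    ((((hc 6).mul (hc c)).mul hν).mul ((h.grad_analytic hy hν).inner gK))

/-- Multiplied by `(1 - ν²)²`, the curvature identity follows from Bochner's formula. -/
theorem sq_mul_curvatureDefect_eq_zero (h : IsOrthonormalFrame U E₁ E₂) (hy : y ∈ U) (c : ℝ)
    {ν : M → ℝ} (hν : AnalyticFunAt ν y)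
    (h_grad : ∀ x, ‖grad ν x‖ ^ 2 = -(1 - ν x ^ 2) * (gaussCurvature x - c * ν x ^ 2))
    (h_laplacian : ∀ x,
      laplacian ν x - 2 * gaussCurvature x * ν x + c * (1 + ν x ^ 2) * ν x = 0) :
    (1 - ν y ^ 2) ^ 2 * curvatureDefect c ν y = 0 := by
  have hK := h.gaussCurvature_analytic hy
  have hc : ∀ r : ℝ, AnalyticFunAt (fun _ : M ↦ r) y := AnalyticFunAt.const
  have hu := hν.mul hν
  have hcu := (hc c).mul hu
  -- The factors are written as sums, so that `laplacian_mul` and `laplacian_add` apply to them as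
  -- they stand.
  have e : (fun z ↦ dirDeriv E₁ ν z * dirDeriv E₁ ν z + dirDeriv E₂ ν z * dirDeriv E₂ ν z) =ᶠ[𝓝 y]
      fun z ↦ (ν z * ν z + -1) * (gaussCurvature z + -(c * (ν z * ν z))) := by
    filter_upwards [h.mem_nhds hy] with z hz
    rw [← h.inner_grad hz, real_inner_self_eq_norm_sq, h_grad]
    ring
  have hm1 : AnalyticFunAt (fun z ↦ ν z * ν z + -1) y := hu.add (hc (-1))
  have hm2 : AnalyticFunAt (fun z ↦ gaussCurvature z + -(c * (ν z * ν z))) y := hK.add hcu.neg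
  have d1 : ∀ E : ∀ x : M, TangentSpace (𝓡 2) x,
      dirDeriv E (fun z ↦ ν z * ν z + -1) y = 2 * ν y * dirDeriv E ν y := fun E ↦ by
    rw [dirDeriv_add hu (hc (-1)), dirDeriv_const, dirDeriv_mul hν hν]
    ring
  have d2 : ∀ E : ∀ x : M, TangentSpace (𝓡 2) x,
      dirDeriv E (fun z ↦ gaussCurvature z + -(c * (ν z * ν z))) y =
        dirDeriv E gaussCurvature y - 2 * c * ν y * dirDeriv E ν y := fun E ↦ by
    rw [dirDeriv_add hK hcu.neg, dirDeriv_neg, dirDeriv_mul (hc c) hu, dirDeriv_const,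
      dirDeriv_mul hν hν]
    ring
  -- The Laplace equation holds at every point, hence is an equality of functions and can be
  -- differentiated.
  have eL : laplacian ν = fun z ↦
      2 * (gaussCurvature z * ν z) - c * ((ν z * ν z) * ν z + ν z) := funext fun z ↦ by
    linear_combination h_laplacian z
  have dL : ∀ E : ∀ x : M, TangentSpace (𝓡 2) x, dirDeriv E (laplacian ν) y =
      2 * gaussCurvature y * dirDeriv E ν y + 2 * ν y * dirDeriv E gaussCurvature y
        - c * (1 + 3 * ν y ^ 2) * dirDeriv E ν y := fun E ↦ by
    rw [eL, dirDeriv_sub ((hc 2).mul (hK.mul hν)) ((hc c).mul ((hu.mul hν).add hν)),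
      dirDeriv_mul (hc 2) (hK.mul hν), dirDeriv_mul hK hν,
      dirDeriv_mul (hc c) ((hu.mul hν).add hν), dirDeriv_add (hu.mul hν) hν,
      dirDeriv_mul hu hν, dirDeriv_mul hν hν, dirDeriv_const, dirDeriv_const]
    ring
  have lap_congr : laplacian (fun z ↦ dirDeriv E₁ ν z * dirDeriv E₁ ν z
        + dirDeriv E₂ ν z * dirDeriv E₂ ν z) y =
      laplacian (fun z ↦ (ν z * ν z + -1) * (gaussCurvature z + -(c * (ν z * ν z)))) y := by
    have dd : ∀ E : ∀ x : M, TangentSpace (𝓡 2) x,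
        dirDeriv E (fun z ↦ dirDeriv E₁ ν z * dirDeriv E₁ ν z
          + dirDeriv E₂ ν z * dirDeriv E₂ ν z) =ᶠ[𝓝 y]
        dirDeriv E fun z ↦ (ν z * ν z + -1) * (gaussCurvature z + -(c * (ν z * ν z))) :=
      -- The Laplacian involves second derivatives, so the first derivatives must agree on a
      -- neighbourhood and not merely at `y`.
      fun E ↦ e.eventuallyEq_nhds.mono fun z hz ↦ dirDeriv_congr hz
    have ha := hm1.mul hm2
    rw [h.laplacian_eq hy ha, h.laplacian_eq hy (ha.congr e), dirDeriv_congr (dd E₁),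
      dirDeriv_congr (dd E₂), (dd E₁).eq_of_nhds, (dd E₂).eq_of_nhds]
  have negcu : (fun z ↦ -(c * (ν z * ν z))) = fun z ↦ (-c) * (ν z * ν z) := funext fun z ↦ by ring
  have F4 := h.bochner hy hν
  rw [lap_congr, h.laplacian_mul hy hm1 hm2, d1, d1, d2, d2, dL, dL,
    h.laplacian_add hy hu (hc (-1)), h.laplacian_const hy, h.laplacian_add hy hK hcu.neg, negcu,
    h.laplacian_mul hy (hc (-c)) hu, h.laplacian_const hy, h.laplacian_mul hy hν hν,
    dirDeriv_const, dirDeriv_const, eL] at F4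
  have F0 := e.eq_of_nhds
  have F1 := h.dirDeriv₁_norm_sq hy hν
  rw [dirDeriv_congr e, dirDeriv_mul hm1 hm2, d1, d2] at F1
  have F2 := h.dirDeriv₂_norm_sq hy hν
  rw [dirDeriv_congr e, dirDeriv_mul hm1 hm2, d1, d2] at F2
  have F3 := h.laplacian_eq_hessian hy hν
  rw [eL] at F3
  have key := curvature_identity_of_frame (ν y) (dirDeriv E₁ ν y) (dirDeriv E₂ ν y)
    (gaussCurvature y) (dirDeriv E₁ gaussCurvature y) (dirDeriv E₂ gaussCurvature y) c
    (hessian₁₁ E₁ E₂ ν y) (hessian₁₂ E₁ E₂ ν y) (hessian₂₂ E₁ E₂ ν y)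
    (laplacian gaussCurvature y) (by linear_combination F0) (by linear_combination -F1)
    (by linear_combination -F2) (by linear_combination -F3) (by linear_combination F4)
  rw [curvatureDefect, h.inner_grad hy, h.inner_grad hy]
  linear_combination key

/-- Where `ν² = 1` on an open set, the surface has constant curvature `c`. -/
theorem curvatureDefect_eq_zero_of_sq_eq_one (h : IsOrthonormalFrame U E₁ E₂) (hy : y ∈ U) (c : ℝ)
    {ν : M → ℝ} (hν : AnalyticFunAt ν y) (h_one : ∀ᶠ z in 𝓝 y, ν z ^ 2 = 1)
    (h_laplacian : ∀ x,
      laplacian ν x - 2 * gaussCurvature x * ν x + c * (1 + ν x ^ 2) * ν x = 0) :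
    curvatureDefect c ν y = 0 := by
  have hd : ∀ E : ∀ x : M, TangentSpace (𝓡 2) x, dirDeriv E ν =ᶠ[𝓝 y] fun _ ↦ 0 := by
    intro E
    filter_upwards [h_one.eventually_nhds, hν.eventually] with z hz hνz
    have e : (fun w ↦ ν w * ν w) =ᶠ[𝓝 z] fun _ ↦ 1 := hz.mono fun w hw ↦ by
      rw [← hw]; ring
    have h1 := dirDeriv_congr (X := E) e
    rw [dirDeriv_mul hνz hνz, dirDeriv_const] at h1
    have h2 : ν z ≠ 0 := fun h0 ↦ by simpa [h0] using hz.self_of_nhds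
    have h3 : ν z * dirDeriv E ν z = 0 := by linear_combination h1 / 2
    exact (mul_eq_zero.1 h3).resolve_left h2
  have hK : gaussCurvature =ᶠ[𝓝 y] fun _ ↦ c := by
    filter_upwards [h_one, (hd E₁).eventuallyEq_nhds, (hd E₂).eventuallyEq_nhds, h.mem_nhds hy,
      hν.eventually] with z hz hz1 hz2 hzU hνz
    have hL := h_laplacian z
    rw [h.laplacian_eq hzU hνz, dirDeriv_congr hz1, dirDeriv_congr hz2, hz1.eq_of_nhds,
      hz2.eq_of_nhds, dirDeriv_const, dirDeriv_const, hz] at hL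
    have h2 : ν z ≠ 0 := fun h0 ↦ by simp [h0] at hz
    have h3 : ν z * (gaussCurvature z - c) = 0 := by linear_combination (-1 / 2) * hL
    exact sub_eq_zero.1 ((mul_eq_zero.1 h3).resolve_left h2)
  have dK : ∀ E : ∀ x : M, TangentSpace (𝓡 2) x, dirDeriv E gaussCurvature y = 0 := fun E ↦ by
    rw [dirDeriv_congr hK, dirDeriv_const]
  -- With K = c and ν² = 1 the factor K − cν² vanishes, so ΔK need not be computed.
  rw [curvatureDefect, h.inner_grad hy, h.inner_grad hy, dK, dK, hK.eq_of_nhds,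
    h_one.self_of_nhds]
  ring

end IsOrthonormalFrame

end CurvatureIdentity
end RiemannianSurface

theorem proposition3p2
    {M : Type*} [TopologicalSpace M] [ChartedSpace (EuclideanSpace ℝ (Fin 2)) M]
    [IsManifold (𝓡 2) ω M] [RiemannianBundle (fun x : M ↦ TangentSpace (𝓡 2) x)]
    [IsContMDiffRiemannianBundle (𝓡 2) ω (EuclideanSpace ℝ (Fin 2))
      (fun x : M ↦ TangentSpace (𝓡 2) x)]
    (c : ℝ) (hc : c ≠ 0)
    (K : M → ℝ) (hK : K = RiemannianSurface.gaussCurvature)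
    (ν : M → ℝ) (hν : ContMDiff (𝓡 2) 𝓘(ℝ) ω ν) (hν_mem : ∀ x, ν x ∈ Set.Icc (-1 : ℝ) 1)
    (h_grad : ∀ x, ‖RiemannianSurface.grad ν x‖ ^ 2 = -(1 - ν x ^ 2) * (K x - c * ν x ^ 2))
    (h_laplacian : ∀ x, RiemannianSurface.laplacian ν x - 2 * K x * ν x + c * (1 + ν x ^ 2) * ν x = 0) :
    ∀ x,
      6 * c * ν x * inner ℝ (RiemannianSurface.grad ν x) (RiemannianSurface.grad K x) =
        ‖RiemannianSurface.grad K x‖ ^ 2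
          - (K x - c * ν x ^ 2) * RiemannianSurface.laplacian K x
          + 4 * (K x - c) * (K x - c * ν x ^ 2) * (K x + 2 * c * ν x ^ 2) := by
  intro x
  subst hK
  obtain ⟨U, E₁, E₂, hx, h⟩ := RiemannianSurface.exists_isOrthonormalFrame x
  have hνx : RiemannianSurface.AnalyticFunAt ν x := hν x
  suffices hF : RiemannianSurface.curvatureDefect c ν x = 0 by
    rw [RiemannianSurface.curvatureDefect, real_inner_self_eq_norm_sq] at hF
    linear_combination -hF
  -- Continuity of the defect spreads its non-vanishing to a neighbourhood of `x`, where the factor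
  -- (1 − ν²)² must then vanish identically.
  by_contra hF
  refine hF (h.curvatureDefect_eq_zero_of_sq_eq_one hx c hνx ?_ h_laplacian)
  filter_upwards [h.mem_nhds hx,
    (h.curvatureDefect_analytic hx c hνx).continuousAt.eventually_ne hF] with z hz hFz
  have h0 := h.sq_mul_curvatureDefect_eq_zero hz c (hν z) h_grad h_laplacian
  have h1 := pow_eq_zero_iff two_ne_zero |>.1 ((mul_eq_zero.1 h0).resolve_right hFz)
  linear_combination -h1
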